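/- Fix an orthonormal basis $\{e_m\}_{m=1}^n$ of $\mathbb{R}^n$ with respect to an inner product $\langle\cdot,\cdot\rangle$; write $x(l)=\langle x,e_l\rangle$ and $\|x\|_p=\left(\sum_{m=1}^n|x(m)|^p\right)^{1/p}$. For integers $1\le j\le k$ put $$\mathcal{S}_j(x_1,\dots,x_k)=\sum_{l=1}^n\ \sum_{1\le i_1<\dots<i_j\le k}x_{i_1}(l)\cdots x_{i_j}(l),\qquad x_1,\dots,x_k\in\mathbb{R}^n .$$ A function $f:\mathbb{R}^n\to\mathbb{R}$ is called unconditional if $f\left(\sum_m\delta_m a_m e_m\right)=f\left(\sum_m a_m e_m\right)$ for all $\delta_m\in\{-1,1\}$ and $a_m\in\mathbb{R}$. **Theorem (functional $j$-Santaló inequality).** Let $2\le j\le k$ be integers, let $\rho:\mathbb{R}\to[0,\infty]$ be decreasing (not necessarily strictly), and let $f_1,\dots,f_k:\mathbb{R}^n\to[0,\infty)$ be even integrable functions such that $$\prod_{i=1}^k f_i(x_i)\le\rho\left(\mathcal{S}_j(x_1,\dots,x_k)\right)\qquad\text{for all }x_1,\dots,x_k\in\mathbb{R}^n .$$ Assume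 that at least one of the following holds: (i) $f_1,\dots,f_k$ are unconditional; (ii) $j=k$; (iii) $j$ is even and $f_3,\dots,f_k$ are unconditional. Then $$\prod_{i=1}^k\int_{\mathbb{R}^n}f_i(x_i)\,dx_i\le\left(\int_{\mathbb{R}^n}\rho\left(\binom kj\|u\|_j^j\right)^{1/k}du\right)^k,$$ where the right-hand side may be $+\infty$. -/

import Mathlib

open MeasureTheory
open scoped ENNReal

namespace JSantalo

/-- The elementary symmetric polynomial `s_j(r_1, …, r_k)` of degree `j` in `k` real variables. -/
noncomputable def elemSymm (j : ℕ) {k : ℕ} (r : Fin k → ℝ) : ℝ :=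
  MvPolynomial.eval r (MvPolynomial.esymm (Fin k) ℝ j)

section

variable {E : Type*} [NormedAddCommGroup E] [InnerProductSpace ℝ E] {n : ℕ}

/-- `𝓢_j(x_1, …, x_k) = ∑_l s_j(x_1(l), …, x_k(l))`, where `x(l) = ⟨x, e_l⟩` is the `l`-th
coordinate of `x` in the orthonormal basis `b = {e_l}`. -/
noncomputable def bigS (b : OrthonormalBasis (Fin n) ℝ E) (j : ℕ) {k : ℕ} (x : Fin k → E) : ℝ :=
  ∑ l : Fin n, elemSymm j (fun i => inner ℝ (x i) (b l))

/-- `‖x‖_p = (∑_m |⟨x, e_m⟩|^p)^{1/p}` with respect to the orthonormal basis `b = {e_m}`. -/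
noncomputable def pNorm (b : OrthonormalBasis (Fin n) ℝ E) (p : ℝ) (x : E) : ℝ :=
  (∑ m : Fin n, |inner ℝ x (b m)| ^ p) ^ (1 / p)

/-- `f` is unconditional with respect to the orthonormal basis `b`: its values do not change when
the signs of coordinates are changed. -/
def Unconditional (b : OrthonormalBasis (Fin n) ℝ E) (f : E → ℝ) : Prop :=
  ∀ δ : Fin n → ℝ, (∀ m, δ m = 1 ∨ δ m = -1) → ∀ a : Fin n → ℝ,
    f (∑ m, (δ m * a m) • b m) = f (∑ m, a m • b m)

end

/-- The functions `f_1, …, f_k` (nonnegative in the application) satisfy the `Φ`-polarity condition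
with respect to `ρ : ℝ → [0, ∞]`. -/
def PolarityCondition {E : Type*} {k : ℕ} (Φ : (Fin k → E) → ℝ) (f : Fin k → E → ℝ)
    (ρ : ℝ → ℝ≥0∞) : Prop :=
  ∀ x : Fin k → E, ENNReal.ofReal (∏ i, f i (x i)) ≤ ρ (Φ x)

end JSantalo

namespace JSantalo

/-! ### Layer cake formula. -/

section Layercake

/-! If all `f i` are unconditional, only absolute values of coordinates matter. Maclaurin's
inequality bounds `elemSymm j` below by `k.choose j` times the `j`-th power of the geometric mean,
so the polarity condition becomes the hypothesis of a Prékopa–Leindler inequality for coordinatewise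
geometric means with `h = ρ ^ (1/k)`; its conclusion is the claim
(`prod_lintegral_le_of_signInvariant`).

The other cases reduce to this one by a Steiner-type symmetrization. For a pair of indices and a
coordinate `l`, one function is symmetrized along the axis `l` and the other along the complementary
hyperplane. Brunn–Minkowski shows that integrals do not decrease
(`lintegral_le_lintegral_symmetrize`). The polarity condition survives (`prod_symmetrizePair_le`)
because `coordS` is affine along the paired displacements and is unchanged by a suitable reflection:
two sign changes cancel when `j = k`, and a common sign change is harmless when `j` is even.
Evenness turns symmetry in the hyperplane into symmetry in the axis, and earlier symmetries persist,
so finitely many steps make every function unconditional (`exists_signInvariant`).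

Symmetrization is carried out on functions with compact superlevel sets, which approximate the given
ones from below; this keeps suprema attained and everything measurable. -/

lemma volume_Ioi_lt_ofReal (a : ℝ≥0∞) :
    volume (Set.Ioi (0 : ℝ) ∩ {t : ℝ | ENNReal.ofReal t < a}) = a := by
  by_cases ha : a = ∞
  · subst ha
    simp
  · have : Set.Ioi (0 : ℝ) ∩ {t : ℝ | ENNReal.ofReal t < a} = Set.Ioo 0 a.toReal := by
      ext t
      simp only [Set.mem_inter_iff, Set.mem_Ioi, Set.mem_ofPred_eq, Set.mem_Ioo, and_congr_right_iff]
      intro ht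
      rw [ENNReal.ofReal_lt_iff_lt_toReal ht.le ha]
    rw [this, Real.volume_Ioo, sub_zero, ENNReal.ofReal_toReal ha]

/-- The layer cake formula for functions with values in `[0, ∞]`. -/
lemma lintegral_eq_lintegral_superlevel {α : Type*} [MeasurableSpace α] (μ : Measure α)
    [SFinite μ] {F : α → ℝ≥0∞} (hF : Measurable F) :
    ∫⁻ x, F x ∂μ = ∫⁻ t in Set.Ioi (0 : ℝ), μ {x | ENNReal.ofReal t < F x} := by
  have hm : MeasurableSet {p : α × ℝ | ENNReal.ofReal p.2 < F p.1} :=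
    measurableSet_lt (by fun_prop) (by fun_prop)
  have h1 : ∀ x, F x = ∫⁻ t in Set.Ioi (0 : ℝ),
      {p : α × ℝ | ENNReal.ofReal p.2 < F p.1}.indicator (fun _ => (1 : ℝ≥0∞)) (x, t) := by
    intro x
    have : (fun t : ℝ => {p : α × ℝ | ENNReal.ofReal p.2 < F p.1}.indicator
        (fun _ => (1 : ℝ≥0∞)) (x, t)) = {t : ℝ | ENNReal.ofReal t < F x}.indicator 1 := by
      ext t; simp [Set.indicator]
    rw [this, lintegral_indicator_one (measurableSet_lt (by fun_prop) (by fun_prop)),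
      Measure.restrict_apply (measurableSet_lt (by fun_prop) (by fun_prop)), Set.inter_comm,
      volume_Ioi_lt_ofReal]
  calc ∫⁻ x, F x ∂μ = ∫⁻ x, ∫⁻ t in Set.Ioi (0 : ℝ),
      {p : α × ℝ | ENNReal.ofReal p.2 < F p.1}.indicator (fun _ => (1 : ℝ≥0∞)) (x, t) ∂volume ∂μ :=
        lintegral_congr h1
    _ = ∫⁻ t in Set.Ioi (0 : ℝ), ∫⁻ x,
      {p : α × ℝ | ENNReal.ofReal p.2 < F p.1}.indicator (fun _ => (1 : ℝ≥0∞)) (x, t) ∂μ ∂volume :=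
        lintegral_lintegral_swap (f := fun x t => {p : α × ℝ | ENNReal.ofReal p.2 < F p.1}.indicator
          (fun _ => (1 : ℝ≥0∞)) (x, t)) (measurable_const.indicator hm).aemeasurable
    _ = _ := by
        refine lintegral_congr fun t => ?_
        have : (fun x : α => {p : α × ℝ | ENNReal.ofReal p.2 < F p.1}.indicator
          (fun _ => (1 : ℝ≥0∞)) (x, t)) = {x | ENNReal.ofReal t < F x}.indicator 1 := by
          ext x; simp [Set.indicator]
        rw [this, lintegral_indicator_one (measurableSet_lt (by fun_prop) (by fun_prop))]

end Layercake

/-! ### Brunn–Minkowski on the line. -/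

section BrunnMinkowski

open scoped Pointwise

/-- The one-dimensional Brunn–Minkowski inequality for two compact sets. -/
lemma volume_add_volume_le_of_isCompact {A B : Set ℝ} (hA : IsCompact A) (hB : IsCompact B)
    (hA0 : A.Nonempty) (hB0 : B.Nonempty) : volume A + volume B ≤ volume (A + B) := by
  obtain ⟨a, ha, hamax⟩ := hA.exists_isGreatest hA0
  obtain ⟨b, hb, hbmin⟩ := hB.exists_isLeast hB0
  have hAm : volume ((fun x => x + b) '' A) = volume A := by simp
  have hBm : volume ((fun x => a + x) '' B) = volume B := by simp
  -- With `a = max A` and `b = min B`, these translates lie in `A + B` on opposite sides of `a + b`.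
  have hint : volume (((fun x => x + b) '' A) ∩ ((fun x => a + x) '' B)) = 0 := by
    refine measure_mono_null (t := {a + b}) ?_ (by simp)
    rintro _ ⟨⟨x, hx, rfl⟩, ⟨y, hy, hxy⟩⟩
    have h1 := hamax hx
    have h2 := hbmin hy
    simp only [Set.mem_singleton_iff] at *
    linarith
  rw [← hAm, ← hBm, ← measure_union_add_inter _ (hB.image (by fun_prop)).measurableSet, hint,
    add_zero]
  refine measure_mono (Set.union_subset ?_ ?_)
  · rintro _ ⟨x, hx, rfl⟩
    exact Set.add_mem_add hx hb
  · rintro _ ⟨x, hx, rfl⟩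
    exact Set.add_mem_add ha hx

lemma sum_volume_le_of_isCompact {ι : Type*} (s : Finset ι) {A : ι → Set ℝ}
    (hA : ∀ i, IsCompact (A i)) (hA0 : ∀ i, (A i).Nonempty) :
    (∑ i ∈ s, volume (A i) ≤ volume (∑ i ∈ s, A i)) ∧ IsCompact (∑ i ∈ s, A i) ∧
      (∑ i ∈ s, A i).Nonempty := by
  classical
  induction s using Finset.induction_on with
  | empty => simp
  | insert i s hi ih =>
    simp only [Finset.sum_insert hi]
    refine ⟨?_, (hA i).add ih.2.1, (hA0 i).add ih.2.2⟩
    exact (by gcongr; exact ih.1 : _ ≤ volume (A i) + volume (∑ i ∈ s, A i)).trans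
      (volume_add_volume_le_of_isCompact (hA i) ih.2.1 (hA0 i) ih.2.2)

/-- The one-dimensional Brunn–Minkowski inequality for finitely many measurable sets. -/
lemma sum_volume_le_of_sum_mem {ι : Type*} [Fintype ι] {A : ι → Set ℝ} {C : Set ℝ}
    (hA : ∀ i, MeasurableSet (A i)) (hA0 : ∀ i, (A i).Nonempty)
    (hC : ∀ x : ι → ℝ, (∀ i, x i ∈ A i) → ∑ i, x i ∈ C) :
    ∑ i, volume (A i) ≤ volume C := by
  have key : ∀ K : ι → Set ℝ, (∀ i, K i ⊆ A i ∧ IsCompact (K i)) →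
      ∑ i, volume (K i) ≤ volume C := by
    intro K hK
    choose p hp using hA0
    -- Adjoining a point of `A i` covers the case of an empty `K i`.
    have h := (sum_volume_le_of_isCompact Finset.univ (A := fun i => K i ∪ {p i})
      (fun i => (hK i).2.union isCompact_singleton) (fun i => ⟨p i, by simp⟩)).1
    refine (Finset.sum_le_sum fun i _ => measure_mono Set.subset_union_left).trans
      (h.trans (measure_mono ?_))
    intro y hy
    rw [Set.mem_fintype_sum] at hy
    obtain ⟨x, hx, rfl⟩ := hy
    refine hC x fun i => ?_
    rcases hx i with h | h
    · exact (hK i).1 h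
    · rw [Set.mem_singleton_iff.1 h]; exact hp i
  have hseq : ∀ i, ∃ u : ℕ → Set ℝ, (∀ m, u m ⊆ A i ∧ IsCompact (u m)) ∧
      Filter.Tendsto (fun m => volume (u m)) Filter.atTop (nhds (volume (A i))) := by
    intro i
    have hsup : volume (A i) = sSup ((fun K => volume K) '' {K : Set ℝ | K ⊆ A i ∧ IsCompact K}) := by
      rw [(hA i).measure_eq_iSup_isCompact, sSup_image]
      simp only [Set.mem_ofPred_eq, iSup_and]
    obtain ⟨u, -, hu, hmem⟩ := exists_seq_tendsto_sSup
      (S := (fun K => volume K) '' {K : Set ℝ | K ⊆ A i ∧ IsCompact K})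
      ⟨_, ∅, ⟨Set.empty_subset _, isCompact_empty⟩, rfl⟩ (OrderTop.bddAbove _)
    choose v hv hvu using hmem
    refine ⟨v, hv, ?_⟩
    rw [hsup]
    simpa only [hvu] using hu
  choose u hu hut using hseq
  exact le_of_tendsto (tendsto_finsetSum _ fun i _ => hut i)
    (Filter.Eventually.of_forall fun m => key (fun i => u i m) fun i => hu i m)

end BrunnMinkowski

/-! ### Prékopa–Leindler for arithmetic and geometric means. -/

section PrekopaLeindler

lemma prod_iSup_of_monotone {ι : Type*} (s : Finset ι) {a : ι → ℕ → ℝ≥0∞}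
    (ha : ∀ i, Monotone (a i)) : ∏ i ∈ s, ⨆ m, a i m = ⨆ m, ∏ i ∈ s, a i m := by
  classical
  induction s using Finset.induction_on with
  | empty => simp
  | insert i s hi ih =>
    simp only [Finset.prod_insert hi, ih, ENNReal.iSup_mul, ENNReal.mul_iSup]
    refine le_antisymm (iSup_le fun m => iSup_le fun m' => ?_)
      (iSup_le fun m => le_iSup_of_le m (le_iSup_of_le m le_rfl))
    refine le_iSup_of_le (max m m') ?_
    gcongr with l
    · exact ha i (le_max_right _ _)
    · exact ha l (le_max_left _ _)

lemma pow_card_lt_prod {ι : Type*} {s : Finset ι} (hs : s.Nonempty) {a : ι → ℝ≥0∞} {c : ℝ≥0∞}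
    (h : ∀ i ∈ s, c < a i) : c ^ s.card < ∏ i ∈ s, a i := by
  induction hs using Finset.Nonempty.cons_induction with
  | singleton i => simpa using h i (by simp)
  | cons i s hi hs ih =>
    rw [Finset.card_cons, Finset.prod_cons, pow_succ']
    exact ENNReal.mul_lt_mul (h i (by simp)) (ih fun l hl => h l (by simp [hl]))

lemma antitone_measure_superlevel {α : Type*} [MeasurableSpace α] (μ : Measure α)
    (F : α → ℝ≥0∞) : Antitone fun t : ℝ => μ {x | ENNReal.ofReal t < F x} :=
  fun _ _ hst => measure_mono fun _ hx => lt_of_le_of_lt (ENNReal.ofReal_le_ofReal hst) hx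

lemma prod_le_inv_mul_sum_pow {k : ℕ} (hk : k ≠ 0) (a : Fin k → ℝ≥0∞) :
    ∏ i, a i ≤ ((k : ℝ≥0∞)⁻¹ * ∑ i, a i) ^ k := by
  by_cases htop : ∃ i, a i = ∞
  · obtain ⟨i, hi⟩ := htop
    have : ∑ i, a i = ∞ := ENNReal.sum_eq_top.2 ⟨i, Finset.mem_univ _, hi⟩
    rw [this, ENNReal.mul_top (by simp), ENNReal.top_pow hk]
    exact le_top
  · push Not at htop
    lift a to Fin k → NNReal using htop
    have h := NNReal.geom_mean_le_arith_mean_weighted Finset.univ (fun _ : Fin k => (k : NNReal)⁻¹) a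
      (by simp [hk])
    have h2 := pow_le_pow_left' h k
    rw [← Finset.prod_pow] at h2
    have h3 : ∀ i, (a i ^ (((k : NNReal)⁻¹ : NNReal) : ℝ)) ^ k = a i := by
      intro i
      push_cast
      exact NNReal.rpow_inv_natCast_pow _ hk
    simp only [h3, ← Finset.mul_sum] at h2
    rw [← ENNReal.coe_natCast, ← ENNReal.coe_inv (by simpa using hk)]
    simp only
    exact_mod_cast h2

/-- A measure `μ` satisfies the `k`-function Prékopa–Leindler inequality for the mean `m`. -/
def PrekopaLeindler {X : Type*} [MeasurableSpace X] (μ : Measure X) {k : ℕ}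
    (m : (Fin k → X) → X) : Prop :=
  ∀ (f : Fin k → X → ℝ≥0∞) (h : X → ℝ≥0∞), (∀ i, Measurable (f i)) → Measurable h →
    (∀ x : Fin k → X, ∏ i, f i (x i) ≤ h (m x) ^ k) → ∏ i, ∫⁻ x, f i x ∂μ ≤ (∫⁻ x, h x ∂μ) ^ k

/-- With equal suprema, the superlevel sets of the `f i` are nonempty for the same levels `t < 1`,
so Brunn–Minkowski applies level by level. Integrating in `t` bounds the arithmetic mean of the
integrals, which dominates their geometric mean. -/
lemma prekopaLeindler_of_iSup_eq_one {k : ℕ} (hk : k ≠ 0) {f : Fin k → ℝ → ℝ≥0∞}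
    {h : ℝ → ℝ≥0∞} (hf : ∀ i, Measurable (f i)) (hh : Measurable h)
    (hfh : ∀ x : Fin k → ℝ, ∏ i, f i (x i) ≤ h ((k : ℝ)⁻¹ * ∑ i, x i) ^ k)
    (hsup : ∀ i, ⨆ x, f i x = 1) :
    ∏ i, ∫⁻ x, f i x ≤ (∫⁻ x, h x) ^ k := by
  refine (prod_le_inv_mul_sum_pow hk _).trans (pow_le_pow_left' ?_ k)
  have hk' : (k : ℝ) ≠ 0 := by exact_mod_cast hk
  simp only [lintegral_eq_lintegral_superlevel volume (hf _),
    lintegral_eq_lintegral_superlevel volume hh]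
  rw [← lintegral_finsetSum', ← lintegral_const_mul'']
  · refine lintegral_mono_ae ?_
    filter_upwards [ae_restrict_mem measurableSet_Ioi] with t ht
    have ht0 : 0 < t := ht
    rcases lt_or_ge (ENNReal.ofReal t) 1 with ht1 | ht1
    · have hmain := sum_volume_le_of_sum_mem (A := fun i => {x | ENNReal.ofReal t < f i x})
        (C := (fun y => (k : ℝ)⁻¹ * y) ⁻¹' {x | ENNReal.ofReal t < h x})
        (fun i => measurableSet_lt measurable_const (hf i)) (fun i => ?_) ?_
      · rw [Real.volume_preimage_mul_left (inv_ne_zero hk'), inv_inv, abs_of_nonneg (by positivity),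
          ENNReal.ofReal_natCast] at hmain
        calc _ ≤ (k : ℝ≥0∞)⁻¹ * (k * volume {x | ENNReal.ofReal t < h x}) := by gcongr
          _ = _ := by
            rw [← mul_assoc, ENNReal.inv_mul_cancel (by simpa using hk) (by simp), one_mul]
      · rw [← hsup i] at ht1
        exact lt_iSup_iff.1 ht1
      · intro x hx
        have h1 : ENNReal.ofReal t ^ k < ∏ i, f i (x i) := by
          have := pow_card_lt_prod (s := Finset.univ) (c := ENNReal.ofReal t)
            ⟨⟨0, Nat.pos_of_ne_zero hk⟩, Finset.mem_univ _⟩ (fun i _ => hx i)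
          simpa using this
        exact lt_of_pow_lt_pow_left' k (h1.trans_le (hfh x))
    · have : ∀ i, {x | ENNReal.ofReal t < f i x} = ∅ := by
        intro i
        ext x
        simp only [Set.mem_ofPred_eq, Set.mem_empty_iff_false, iff_false, not_lt]
        exact ((le_iSup _ x).trans (hsup i).le).trans ht1
      simp [this]
  · exact (Finset.measurable_sum _ fun i _ =>
      (antitone_measure_superlevel volume (f i)).measurable).aemeasurable
  · exact fun i _ => (antitone_measure_superlevel volume (f i)).measurable.aemeasurable

lemma prekopaLeindler_of_iSup_ne_top {k : ℕ} (hk : k ≠ 0) {f : Fin k → ℝ → ℝ≥0∞}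
    {h : ℝ → ℝ≥0∞} (hf : ∀ i, Measurable (f i)) (hh : Measurable h)
    (hfh : ∀ x : Fin k → ℝ, ∏ i, f i (x i) ≤ h ((k : ℝ)⁻¹ * ∑ i, x i) ^ k)
    (hsup : ∀ i, ⨆ x, f i x ≠ ∞) :
    ∏ i, ∫⁻ x, f i x ≤ (∫⁻ x, h x) ^ k := by
  by_cases h0 : ∃ i, ⨆ x, f i x = 0
  · obtain ⟨i, hi⟩ := h0
    rw [Finset.prod_eq_zero (Finset.mem_univ i)]
    · exact zero_le
    · have : f i = 0 := by
        ext x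
        exact le_antisymm ((le_iSup _ x).trans hi.le) zero_le
      simp [this]
  push Not at h0
  set M : Fin k → ℝ≥0∞ := fun i => ⨆ x, f i x with hM
  -- Dividing each `f i` by `M i` and `h` by the geometric mean `c` preserves the hypothesis, since
  -- `c ^ k = ∏ i, M i`.
  set c : ℝ≥0∞ := (∏ i, M i) ^ ((k : ℝ)⁻¹) with hc
  have hck : c ^ k = ∏ i, M i := ENNReal.rpow_inv_natCast_pow hk _
  have hP0 : ∏ i, M i ≠ 0 := Finset.prod_ne_zero_iff.2 fun i _ => h0 i
  have hPt : ∏ i, M i ≠ ∞ := ENNReal.prod_ne_top fun i _ => hsup i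
  have hinv : ∏ i, (M i)⁻¹ = (∏ i, M i)⁻¹ :=
    (ENNReal.prod_inv_distrib fun i _ l _ _ => Or.inl (h0 i)).symm
  have key := prekopaLeindler_of_iSup_eq_one hk (f := fun i x => (M i)⁻¹ * f i x)
    (h := fun x => c⁻¹ * h x) (fun i => (hf i).const_mul _) (hh.const_mul _) (fun x => by
      rw [Finset.prod_mul_distrib, mul_pow, hinv, ← ENNReal.inv_pow, hck]
      gcongr
      exact hfh x) (fun i => by
      rw [← ENNReal.mul_iSup, ENNReal.inv_mul_cancel (h0 i) (hsup i)])
  simp only [lintegral_const_mul _ (hf _), lintegral_const_mul _ hh] at key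
  rw [Finset.prod_mul_distrib, mul_pow, hinv, ← ENNReal.inv_pow, hck] at key
  exact (ENNReal.mul_le_mul_iff_right (ENNReal.inv_ne_zero.2 hPt) (ENNReal.inv_ne_top.2 hP0)).1 key

/-- The Prékopa–Leindler inequality on the real line. -/
theorem prekopaLeindler_real {k : ℕ} (hk : k ≠ 0) :
    PrekopaLeindler (volume : Measure ℝ) fun x : Fin k → ℝ => (k : ℝ)⁻¹ * ∑ i, x i := by
  intro f h hf hh hfh
  -- Truncation makes the suprema finite.
  have htr : ∀ i, ∫⁻ x, f i x = ⨆ N : ℕ, ∫⁻ x, min (f i x) N := by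
    intro i
    rw [← lintegral_iSup (fun N => (hf i).min measurable_const)
      (fun N N' hN x => min_le_min_left _ (by exact_mod_cast hN))]
    refine lintegral_congr fun x => ?_
    rw [← inf_iSup_eq, ENNReal.iSup_natCast, inf_top_eq]
  simp only [htr]
  rw [prod_iSup_of_monotone]
  · refine iSup_le fun N => prekopaLeindler_of_iSup_ne_top hk
      (fun i => (hf i).min measurable_const) hh (fun x => le_trans ?_ (hfh x)) (fun i => ?_)
    · exact Finset.prod_le_prod' fun i _ => min_le_left _ _
    · exact ne_top_of_le_ne_top (ENNReal.natCast_ne_top N) (iSup_le fun x => min_le_right _ _)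
  · intro i N N' hN
    exact lintegral_mono fun x => min_le_min_left _ (by exact_mod_cast hN)

/-- The inequality on `Y`, applied on fibres, is the hypothesis on `X` for the inner integrals. -/
lemma PrekopaLeindler.prod {X Y : Type*} [MeasurableSpace X] [MeasurableSpace Y] {μ : Measure X}
    {ν : Measure Y} [SFinite μ] [SFinite ν] {k : ℕ} {m : (Fin k → X) → X} {m' : (Fin k → Y) → Y}
    (hμ : PrekopaLeindler μ m) (hν : PrekopaLeindler ν m') :
    PrekopaLeindler (μ.prod ν) fun x => (m fun i => (x i).1, m' fun i => (x i).2) := by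
  intro f h hf hh hfh
  simp only [lintegral_prod _ (hf _).aemeasurable, lintegral_prod _ hh.aemeasurable]
  refine hμ (fun i x => ∫⁻ y, f i (x, y) ∂ν) (fun x => ∫⁻ y, h (x, y) ∂ν)
    (fun i => (hf i).lintegral_prod_right') hh.lintegral_prod_right' fun x => ?_
  exact hν (fun i y => f i (x i, y)) (fun y => h (m x, y))
    (fun i => (hf i).comp measurable_prodMk_left) (hh.comp measurable_prodMk_left)
    fun y => hfh fun i => (x i, y i)

lemma PrekopaLeindler.of_measurePreserving {X Y : Type*} [MeasurableSpace X] [MeasurableSpace Y]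
    {μ : Measure X} {ν : Measure Y} {k : ℕ} {m : (Fin k → X) → X} {m' : (Fin k → Y) → Y}
    (hμ : PrekopaLeindler μ m) {e : X → Y} (he : MeasurePreserving e μ ν)
    (hm : ∀ x, e (m x) = m' fun i => e (x i)) : PrekopaLeindler ν m' := by
  intro f h hf hh hfh
  simp only [← he.lintegral_comp (hf _), ← he.lintegral_comp hh]
  refine hμ (fun i x => f i (e x)) (fun x => h (e x)) (fun i => (hf i).comp he.measurable)
    (hh.comp he.measurable) fun x => ?_
  rw [hm]
  exact hfh fun i => e (x i)

lemma PrekopaLeindler.pi_fin {X : Type*} [MeasurableSpace X] {μ : Measure X} [SigmaFinite μ]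
    {k : ℕ} {m : (Fin k → X) → X} (hμ : PrekopaLeindler μ m) (n : ℕ) :
    PrekopaLeindler (Measure.pi fun _ : Fin n => μ) fun x l => m fun i => x i l := by
  induction n with
  | zero =>
    intro f h hf hh hfh
    simp only [Measure.pi_of_empty _ (fun i : Fin 0 => i.elim0), lintegral_dirac' _ (hf _), lintegral_dirac' _ hh]
    refine (hfh _).trans (le_of_eq ?_)
    congr 2
    exact Subsingleton.elim _ _
  | succ n ih =>
    refine (hμ.prod ih).of_measurePreserving
      (measurePreserving_piFinSuccAbove (fun _ : Fin (n + 1) => μ) 0).symm fun x => ?_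
    ext l
    refine Fin.cases ?_ (fun l => ?_) l <;>
    simp [MeasurableEquiv.piFinSuccAbove, Fin.insertNthEquiv]

lemma PrekopaLeindler.pi {ι X : Type*} [Fintype ι] [MeasurableSpace X] {μ : Measure X}
    [SigmaFinite μ] {k : ℕ} {m : (Fin k → X) → X} (hμ : PrekopaLeindler μ m) :
    PrekopaLeindler (Measure.pi fun _ : ι => μ) fun x l => m fun i => x i l := by
  refine (hμ.pi_fin (Fintype.card ι)).of_measurePreserving
    (measurePreserving_piCongrLeft (fun _ : ι => μ) (Fintype.equivFin ι).symm) fun x => ?_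
  ext l
  obtain ⟨l, rfl⟩ := (Fintype.equivFin ι).symm.surjective l
  simp [MeasurableEquiv.coe_piCongrLeft, Equiv.piCongrLeft_apply_apply]

/-- The measure of a set of reals, each point being counted with both its signs. -/
noncomputable def absVolume : Measure ℝ := (volume : Measure ℝ).map abs

/-- Substitution `x = exp t` on the positive half-line; the factor 2 counts the two signs. -/
lemma lintegral_absVolume {F : ℝ → ℝ≥0∞} (hF : Measurable F) :
    ∫⁻ x, F x ∂absVolume = 2 * ∫⁻ t, ENNReal.ofReal (Real.exp t) * F (Real.exp t) := by
  rw [absVolume, lintegral_map hF measurable_abs]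
  have hexp : ∫⁻ x in Set.Ioi (0 : ℝ), F x = ∫⁻ t, ENNReal.ofReal (Real.exp t) * F (Real.exp t) := by
    have := lintegral_image_eq_lintegral_abs_deriv_mul (s := Set.univ) MeasurableSet.univ
      (fun x _ => (Real.hasDerivAt_exp x).hasDerivWithinAt) Real.exp_injective.injOn F
    simpa [Set.image_univ, Real.range_exp, abs_of_pos (Real.exp_pos _)] using this
  have h1 : ∫⁻ x in Set.Ioi (0 : ℝ), F |x| = ∫⁻ x in Set.Ioi (0 : ℝ), F x :=
    setLIntegral_congr_fun measurableSet_Ioi fun x hx => by simp only [abs_of_pos (Set.mem_Ioi.1 hx)]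
  have h2 : ∫⁻ x in Set.Iio (0 : ℝ), F |x| = ∫⁻ x in Set.Ioi (0 : ℝ), F |x| := by
    have := (Measure.measurePreserving_neg (volume : Measure ℝ)).setLIntegral_comp_preimage
      measurableSet_Ioi (hF.comp measurable_abs) (s := Set.Ioi 0)
    simpa using this
  rw [← hexp, ← lintegral_add_compl _ (measurableSet_Ioi (a := (0 : ℝ))), h1, Set.compl_Ioi,
    setLIntegral_congr Iio_ae_eq_Iic.symm, h2, h1, two_mul]

/-- The Prékopa–Leindler inequality for geometric means. -/
theorem prekopaLeindler_absVolume {k : ℕ} (hk : k ≠ 0) :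
    PrekopaLeindler absVolume fun x : Fin k → ℝ => (∏ i, |x i|) ^ ((k : ℝ)⁻¹) := by
  intro f h hf hh hfh
  simp only [lintegral_absVolume (hf _), lintegral_absVolume hh]
  rw [Finset.prod_mul_distrib, mul_pow]
  simp only [Finset.prod_const, Finset.card_univ, Fintype.card_fin]
  gcongr
  refine prekopaLeindler_real hk _ _ (fun i => by have := hf i; fun_prop) (by fun_prop) fun x => ?_
  have hkr : (k : ℝ) ≠ 0 := by exact_mod_cast hk
  have h1 : (∏ i, |Real.exp (x i)|) ^ ((k : ℝ)⁻¹) = Real.exp ((k : ℝ)⁻¹ * ∑ i, x i) := by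
    simp only [abs_of_pos (Real.exp_pos _)]
    rw [← Real.exp_sum, ← Real.exp_mul, mul_comm]
  -- The Jacobian at the mean is exactly the geometric mean of the Jacobians.
  have h2 : ENNReal.ofReal (Real.exp ((k : ℝ)⁻¹ * ∑ i, x i)) ^ k =
      ∏ i, ENNReal.ofReal (Real.exp (x i)) := by
    rw [← ENNReal.ofReal_pow (Real.exp_pos _).le, ← Real.exp_nat_mul, mul_inv_cancel_left₀ hkr,
      Real.exp_sum, ENNReal.ofReal_prod_of_nonneg fun i _ => (Real.exp_pos _).le]
  rw [Finset.prod_mul_distrib, mul_pow, h2]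
  gcongr
  rw [← h1]
  exact hfh fun i => Real.exp (x i)

end PrekopaLeindler

/-! ### Symmetrization along coordinate subspaces. -/

section Symmetrization

variable {ι : Type*}

/-- Every superlevel set `{c ≤ f}` with `c ≠ 0` is compact. -/
def CompactSuperlevels {X : Type*} [TopologicalSpace X] (f : X → ℝ≥0∞) : Prop :=
  ∀ c, c ≠ 0 → IsCompact {x | c ≤ f x}

lemma CompactSuperlevels.upperSemicontinuous {X : Type*} [TopologicalSpace X] [T2Space X]
    {f : X → ℝ≥0∞} (hf : CompactSuperlevels f) : UpperSemicontinuous f := by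
  rw [upperSemicontinuous_iff_isClosed_preimage]
  intro c
  by_cases hc : c = 0
  · subst hc
    simp
  · exact (hf c hc).isClosed

lemma signs_smul_smul (δ : ι → ℤˣ) (x : ι → ℝ) : δ • δ • x = x := by
  rw [smul_smul, show δ * δ = 1 from funext fun l => Int.units_mul_self _, one_smul]

lemma CompactSuperlevels.measurable [Countable ι] {f : (ι → ℝ) → ℝ≥0∞} (hf : CompactSuperlevels f) :
    Measurable f := hf.upperSemicontinuous.measurable

variable [DecidableEq ι]

/-- The sign vector of the reflection changing the sign of the coordinates in `S`. -/
def flipSigns (S : Finset ι) : ι → ℤˣ := fun l => if l ∈ S then -1 else 1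

/-- Symmetrization of `f` on the affine subspaces parallel to the coordinate subspace `ℝ^S`. -/
noncomputable def symmetrize (S : Finset ι) (f : (ι → ℝ) → ℝ≥0∞) (x : ι → ℝ) : ℝ≥0∞ :=
  ⨆ u : {u : ι → ℝ // ∀ l, l ∉ S → u l = 0},
    min (f (x + u.1)) (f (flipSigns S • x + u.1))

lemma symmetrize_flipSigns_smul (S : Finset ι) (f : (ι → ℝ) → ℝ≥0∞) (x : ι → ℝ) :
    symmetrize S f (flipSigns S • x) = symmetrize S f x := by
  simp only [symmetrize, signs_smul_smul, min_comm]

lemma symmetrize_smul (S : Finset ι) {f : (ι → ℝ) → ℝ≥0∞} {δ : ι → ℤˣ}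
    (hf : ∀ x, f (δ • x) = f x) (x : ι → ℝ) : symmetrize S f (δ • x) = symmetrize S f x := by
  have key : ∀ x, symmetrize S f (δ • x) ≤ symmetrize S f x := by
    intro x
    refine iSup_le fun u => ?_
    refine le_iSup_of_le ⟨δ • u.1, fun l hl => by simp [u.2 l hl]⟩ (le_of_eq ?_)
    rw [← hf (x + _), ← hf (flipSigns S • x + _), smul_add, smul_add, signs_smul_smul,
      smul_comm δ (flipSigns S)]
  refine le_antisymm (key x) ?_
  conv_lhs => rw [← signs_smul_smul δ x]
  exact key _

/-- The combination of two points agreeing off `S` which underlies `symmetrize S`. -/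
noncomputable def halfDiff (S : Finset ι) (p : (ι → ℝ) × (ι → ℝ)) : ι → ℝ :=
  fun l => if l ∈ S then (p.1 l - p.2 l) / 2 else p.1 l

lemma continuous_halfDiff (S : Finset ι) : Continuous (halfDiff S) := by
  refine continuous_pi fun l => ?_
  unfold halfDiff
  split_ifs <;> fun_prop

lemma halfDiff_eq (S : Finset ι) {x u : ι → ℝ} (hu : ∀ l, l ∉ S → u l = 0) :
    halfDiff S (x + u, flipSigns S • x + u) = x := by
  ext l
  by_cases hl : l ∈ S
  · simp [halfDiff, flipSigns, hl]
  · simp [halfDiff, hl, hu l hl]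

/-- Take `u = (a + b) / 2` on `S`: then `a = x + u` and `b = flipSigns S • x + u` for `x = halfDiff
S (a, b)`. -/
lemma le_symmetrize_halfDiff (S : Finset ι) (f : (ι → ℝ) → ℝ≥0∞) {a b : ι → ℝ}
    (hab : ∀ l, l ∉ S → a l = b l) : min (f a) (f b) ≤ symmetrize S f (halfDiff S (a, b)) := by
  refine le_iSup_of_le ⟨fun l => if l ∈ S then (a l + b l) / 2 else 0, fun l hl => by simp [hl]⟩
    (le_of_eq ?_)
  congr 2
  · ext l
    by_cases hl : l ∈ S
    · simp [halfDiff, hl]; ring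
    · simp [halfDiff, hl]
  · ext l
    by_cases hl : l ∈ S
    · simp [halfDiff, flipSigns, hl]; ring
    · simp [halfDiff, flipSigns, hl, hab l hl]

/-- Above a positive level the competing `u` form a compact set, on which an upper semicontinuous
function attains its maximum. -/
lemma exists_symmetrize_eq (S : Finset ι) {f : (ι → ℝ) → ℝ≥0∞} (hf : CompactSuperlevels f)
    {x : ι → ℝ} (hx : symmetrize S f x ≠ 0) :
    ∃ u : ι → ℝ, (∀ l, l ∉ S → u l = 0) ∧
      symmetrize S f x = min (f (x + u)) (f (flipSigns S • x + u)) := by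
  obtain ⟨c, hc0, hc⟩ := exists_between (pos_iff_ne_zero.2 hx)
  set g : (ι → ℝ) → ℝ≥0∞ := fun u => min (f (x + u)) (f (flipSigns S • x + u)) with hg
  have hgu : UpperSemicontinuous g :=
    (hf.upperSemicontinuous.comp (by fun_prop : Continuous fun u => x + u)).inf
      (hf.upperSemicontinuous.comp (by fun_prop : Continuous fun u => flipSigns S • x + u))
  set K : Set (ι → ℝ) := {u | ∀ l, l ∉ S → u l = 0} ∩ {u | c ≤ g u} with hK
  have hKc : IsCompact K := by
    have h1 : IsCompact ((fun u => x + u) ⁻¹' {y | c ≤ f y}) :=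
      (Homeomorph.addLeft x).isCompact_preimage.2 (hf c hc0.ne')
    refine h1.of_isClosed_subset ?_ fun u hu => ?_
    swap
    · exact (le_min_iff.1 (show c ≤ min (f (x + u)) _ from hu.2)).1
    refine IsClosed.inter ?_ (upperSemicontinuous_iff_isClosed_preimage.1 hgu c)
    simp only [Set.ofPred_forall]
    exact isClosed_iInter fun l => isClosed_iInter fun _ =>
      isClosed_eq (continuous_apply l) continuous_const
  obtain ⟨u₀, hu₀⟩ := lt_iSup_iff.1 hc
  obtain ⟨u, hu, hmax⟩ := (hgu.upperSemicontinuousOn K).exists_isMaxOn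
    (show K.Nonempty from ⟨u₀.1, u₀.2, hu₀.le⟩) hKc
  refine ⟨u, hu.1, le_antisymm (iSup_le fun w => ?_) (le_iSup_of_le ⟨u, hu.1⟩ le_rfl)⟩
  by_cases hw : c ≤ g w.1
  · exact isMaxOn_iff.1 hmax w.1 ⟨w.2, hw⟩
  · exact (not_le.1 hw).le.trans hu.2

/-- As the supremum is attained, each superlevel set is the `halfDiff` image of the compact set of
pairs from `{c ≤ f}` agreeing off `S`. -/
lemma CompactSuperlevels.symmetrize (S : Finset ι) {f : (ι → ℝ) → ℝ≥0∞}
    (hf : CompactSuperlevels f) : CompactSuperlevels (symmetrize S f) := by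
  intro c hc
  have hK := (hf c hc).prod (hf c hc)
  have hcl : IsClosed {p : (ι → ℝ) × (ι → ℝ) | ∀ l, l ∉ S → p.1 l = p.2 l} := by
    simp only [Set.ofPred_forall]
    exact isClosed_iInter fun l => isClosed_iInter fun _ =>
      isClosed_eq (by fun_prop) (by fun_prop)
  convert (hK.inter_right hcl).image (continuous_halfDiff S) using 1
  ext x
  constructor
  · intro hx
    have hx' : c ≤ JSantalo.symmetrize S f x := hx
    obtain ⟨u, hu, hxu⟩ := exists_symmetrize_eq S hf (x := x)
      (fun h => hc (le_antisymm (h ▸ hx') zero_le))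
    rw [hxu, le_min_iff] at hx'
    refine ⟨(x + u, flipSigns S • x + u), ⟨hx', fun l hl => ?_⟩, halfDiff_eq S hu⟩
    simp [flipSigns, hl]
  · rintro ⟨⟨a, b⟩, ⟨⟨ha, hb⟩, hab⟩, rfl⟩
    exact (le_min ha hb).trans (le_symmetrize_halfDiff S f hab)

/-- Prékopa–Leindler for the indicators of `A`, `-A` and `C` gives `volume A ^ 2 ≤ volume C ^ 2`. -/
lemma volume_le_of_half_sub_mem {κ : Type*} [Fintype κ] {A C : Set (κ → ℝ)}
    (hA : MeasurableSet A) (hC : MeasurableSet C)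
    (hAC : ∀ a ∈ A, ∀ b ∈ A, (fun l => (a l - b l) / 2) ∈ C) : volume A ≤ volume C := by
  have hAn : MeasurableSet (Neg.neg ⁻¹' A) := measurable_neg hA
  have h := (prekopaLeindler_real two_ne_zero).pi (ι := κ)
    ![A.indicator 1, (Neg.neg ⁻¹' A).indicator 1] (C.indicator 1) (by
      intro i
      fin_cases i
      · exact measurable_one.indicator hA
      · exact measurable_one.indicator hAn) (measurable_one.indicator hC) (by
      intro x
      simp only [Fin.prod_univ_two, Fin.sum_univ_two, Matrix.cons_val_zero, Matrix.cons_val_one]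
      by_cases h0 : x 0 ∈ A
      · by_cases h1 : x 1 ∈ Neg.neg ⁻¹' A
        · have := hAC _ h0 _ h1
          rw [Set.indicator_of_mem h0, Set.indicator_of_mem h1, Set.indicator_of_mem]
          · simp
          · convert this using 2
            simp
            ring
        · rw [Set.indicator_of_notMem h1]; simp
      · rw [Set.indicator_of_notMem h0]; simp)
  simp only [Fin.prod_univ_two, Matrix.cons_val_zero, Matrix.cons_val_one,
    lintegral_indicator_one hA, lintegral_indicator_one hAn, lintegral_indicator_one hC,
    ← volume_pi] at h
  rw [(Measure.measurePreserving_neg (volume : Measure (κ → ℝ))).measure_preimage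
    hA.nullMeasurableSet, ← sq] at h
  exact (ENNReal.pow_le_pow_left_iff two_ne_zero).1 h

variable [Fintype ι]

omit [DecidableEq ι] in
lemma volume_le_of_fiberwise_half_sub_mem (p : ι → Prop) [DecidablePred p] {K L : Set (ι → ℝ)}
    (hK : MeasurableSet K) (hL : MeasurableSet L)
    (hKL : ∀ a ∈ K, ∀ b ∈ K, (∀ l, ¬ p l → a l = b l) →
      (fun l => if p l then (a l - b l) / 2 else a l) ∈ L) :
    volume K ≤ volume L := by
  set e := (MeasurableEquiv.piEquivPiSubtypeProd (fun _ : ι => ℝ) p).symm with he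
  have hmp := (volume_preserving_piEquivPiSubtypeProd (fun _ : ι => ℝ) p).symm
  rw [← he] at hmp
  have happ : ∀ v w l, e (v, w) l = if h : p l then v ⟨l, h⟩ else w ⟨l, h⟩ := fun _ _ _ => rfl
  rw [← hmp.measure_preimage hK.nullMeasurableSet, ← hmp.measure_preimage hL.nullMeasurableSet,
    Measure.volume_eq_prod, Measure.prod_apply_symm (e.measurable hK),
    Measure.prod_apply_symm (e.measurable hL)]
  refine lintegral_mono fun w => volume_le_of_half_sub_mem
    (measurable_prodMk_right (e.measurable hK)) (measurable_prodMk_right (e.measurable hL)) ?_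
  intro a ha b hb
  have := hKL _ ha _ hb fun l hl => by simp [happ, hl]
  show e _ ∈ L
  convert this using 1
  ext l
  by_cases hl : p l <;> simp [happ, hl]

lemma volume_le_of_halfDiff_mem (S : Finset ι) {K L : Set (ι → ℝ)}
    (hK : MeasurableSet K) (hL : MeasurableSet L)
    (hKL : ∀ a ∈ K, ∀ b ∈ K, (∀ l, l ∉ S → a l = b l) → halfDiff S (a, b) ∈ L) :
    volume K ≤ volume L :=
  volume_le_of_fiberwise_half_sub_mem (· ∈ S) hK hL hKL

lemma lintegral_le_lintegral_symmetrize (S : Finset ι) {f : (ι → ℝ) → ℝ≥0∞}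
    (hf : CompactSuperlevels f) : ∫⁻ x, f x ≤ ∫⁻ x, symmetrize S f x := by
  rw [lintegral_eq_lintegral_superlevel volume hf.measurable,
    lintegral_eq_lintegral_superlevel volume (hf.symmetrize S).measurable]
  refine lintegral_mono fun t => volume_le_of_halfDiff_mem S
    (measurableSet_lt measurable_const hf.measurable)
    (measurableSet_lt measurable_const (hf.symmetrize S).measurable) fun a ha b hb hab => ?_
  exact (lt_min ha hb).trans_le (le_symmetrize_halfDiff S f hab)

end Symmetrization

/-! ### Symmetrization preserves polarity; reduction to unconditional functions. -/

section Polarity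

lemma elemSymm_eq_sum (j : ℕ) {k : ℕ} (r : Fin k → ℝ) :
    elemSymm j r = ∑ t ∈ Finset.powersetCard j Finset.univ, ∏ i ∈ t, r i := by
  simp [elemSymm, MvPolynomial.esymm]

/-- `elemSymm j` is affine in each variable separately. -/
lemma elemSymm_update_add_update (j : ℕ) {k : ℕ} (r : Fin k → ℝ) (i : Fin k) (c : ℝ) :
    elemSymm j (Function.update r i (r i + c)) + elemSymm j (Function.update r i (r i - c)) =
      2 * elemSymm j r := by
  simp only [elemSymm_eq_sum, ← Finset.sum_add_distrib, Finset.mul_sum]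
  refine Finset.sum_congr rfl fun t _ => ?_
  by_cases hi : i ∈ t
  · rw [Finset.prod_update_of_mem hi, Finset.prod_update_of_mem hi,
      ← Finset.mul_prod_erase t r hi, Finset.sdiff_singleton_eq_erase]
    ring
  · rw [Finset.prod_update_of_notMem hi, Finset.prod_update_of_notMem hi, two_mul]

lemma elemSymm_neg {j : ℕ} (hj : Even j) {k : ℕ} (r : Fin k → ℝ) :
    elemSymm j (fun i => -r i) = elemSymm j r := by
  simp only [elemSymm_eq_sum]
  refine Finset.sum_congr rfl fun t ht => ?_
  rw [Finset.prod_neg, (Finset.mem_powersetCard.1 ht).2, hj.neg_one_pow, one_mul]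

lemma elemSymm_card {k : ℕ} (r : Fin k → ℝ) : elemSymm k r = ∏ i, r i := by
  have h : Finset.powersetCard k (Finset.univ : Finset (Fin k)) = {Finset.univ} := by
    simpa using Finset.powersetCard_self (Finset.univ : Finset (Fin k))
  rw [elemSymm_eq_sum, h, Finset.sum_singleton]

/-- `𝓢_j` in coordinates. -/
noncomputable def coordS (j : ℕ) {k n : ℕ} (x : Fin k → Fin n → ℝ) : ℝ :=
  ∑ l, elemSymm j fun i => x i l

/-- The disjoint supports of `u` and `w` exclude a quadratic cross term: in each coordinate at most
one variable moves. -/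
lemma coordS_add_coordS (j : ℕ) {k n : ℕ} (x : Fin k → Fin n → ℝ) {i₀ i₁ : Fin k}
    (hi : i₀ ≠ i₁) {u w : Fin n → ℝ} (huw : ∀ l, u l = 0 ∨ w l = 0) :
    coordS j (Function.update (Function.update x i₀ (x i₀ + u)) i₁ (x i₁ + w)) +
      coordS j (Function.update (Function.update x i₀ (x i₀ - u)) i₁ (x i₁ - w)) =
      2 * coordS j x := by
  simp only [coordS, ← Finset.sum_add_distrib, Finset.mul_sum]
  refine Finset.sum_congr rfl fun l _ => ?_
  have h : ∀ a b : Fin n → ℝ, (fun i => Function.update (Function.update x i₀ a) i₁ b i l) =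
      Function.update (Function.update (fun i => x i l) i₀ (a l)) i₁ (b l) := by
    intro a b
    ext i
    by_cases h1 : i = i₁
    · subst h1; simp
    · by_cases h0 : i = i₀
      · subst h0; simp [h1]
      · simp [h0, h1]
  rw [h, h]
  rcases huw l with hu | hw
  · have := elemSymm_update_add_update j (fun i => x i l) i₁ (w l)
    simpa [hu] using this
  · have := elemSymm_update_add_update j (fun i => x i l) i₀ (u l)
    rw [Function.update_comm hi, Function.update_comm hi]
    simpa [hw] using this

lemma min_le_of_antitone {ρ : ℝ → ℝ≥0∞} (hρ : Antitone ρ) {a b c : ℝ} (h : a + b = 2 * c) :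
    min (ρ a) (ρ b) ≤ ρ c := by
  rcases le_total c a with hc | hc
  · exact (min_le_left _ _).trans (hρ hc)
  · exact (min_le_right _ _).trans (hρ (by linarith))

lemma prod_eq_mul_mul_prod_erase {ι : Type*} [Fintype ι] [DecidableEq ι] {i₀ i₁ : ι}
    (hi : i₀ ≠ i₁) (F : ι → ℝ≥0∞) :
    ∏ i, F i = F i₀ * (F i₁ * ∏ i ∈ (Finset.univ.erase i₀).erase i₁, F i) := by
  rw [Finset.mul_prod_erase _ F (by simp [hi.symm]), Finset.mul_prod_erase _ F (by simp)]

/-- Symmetrize `f i₀` in the `l`-th coordinate and `f i₁` in all the others. -/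
noncomputable def symmetrizePair {k n : ℕ} (i₀ i₁ : Fin k) (l : Fin n)
    (f : Fin k → (Fin n → ℝ) → ℝ≥0∞) : Fin k → (Fin n → ℝ) → ℝ≥0∞ :=
  fun i => if i = i₀ then symmetrize {l} (f i) else if i = i₁ then symmetrize {l}ᶜ (f i) else f i

lemma flipSigns_compl {ι : Type*} [Fintype ι] [DecidableEq ι] (S : Finset ι) :
    flipSigns Sᶜ = -flipSigns S := by
  ext l
  by_cases hl : l ∈ S <;> simp [flipSigns, hl]

lemma neg_signs_smul {ι : Type*} (δ : ι → ℤˣ) (x : ι → ℝ) : (-δ) • x = -(δ • x) := by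
  ext l
  simp [Units.neg_smul]

/-- For displacements `u`, `w`, the left side is at most the product at `x + (u, w)` and also the
reflected product at `x - (u, w)`. The two values of `coordS` average to `coordS j x`, so one of
them is at least that, and `ρ` is antitone. -/
lemma prod_symmetrizePair_le (j : ℕ) {k n : ℕ} {f : Fin k → (Fin n → ℝ) → ℝ≥0∞} {ρ : ℝ → ℝ≥0∞}
    (hρ : Antitone ρ) {i₀ i₁ : Fin k} (hi : i₀ ≠ i₁) (l : Fin n) (heven : ∀ x, f i₁ (-x) = f i₁ x)
    (hpol : ∀ x, ∏ i, f i (x i) ≤ ρ (coordS j x))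
    (hpol' : ∀ x : Fin k → Fin n → ℝ, ∏ i, f i (if i = i₀ ∨ i = i₁ then flipSigns {l} • x i else x i)
      ≤ ρ (coordS j x)) (x : Fin k → Fin n → ℝ) :
    ∏ i, symmetrizePair i₀ i₁ l f i (x i) ≤ ρ (coordS j x) := by
  set C := ∏ i ∈ (Finset.univ.erase i₀).erase i₁, f i (x i) with hC
  have hne : ∀ i ∈ (Finset.univ.erase i₀).erase i₁, i ≠ i₀ ∧ i ≠ i₁ := by
    intro i hi'
    simp only [Finset.mem_erase, Finset.mem_univ, and_true] at hi'
    exact ⟨hi'.2, hi'.1⟩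
  have hC' : ∏ i ∈ (Finset.univ.erase i₀).erase i₁, symmetrizePair i₀ i₁ l f i (x i) = C :=
    Finset.prod_congr rfl fun i hi' => by simp [symmetrizePair, hne i hi']
  have hg0 : symmetrizePair i₀ i₁ l f i₀ = symmetrize {l} (f i₀) := by simp [symmetrizePair]
  have hg1 : symmetrizePair i₀ i₁ l f i₁ = symmetrize {l}ᶜ (f i₁) := by
    simp [symmetrizePair, hi.symm]
  rw [prod_eq_mul_mul_prod_erase hi, hC', hg0, hg1, symmetrize, symmetrize, ENNReal.iSup_mul]
  refine iSup_le fun u => ?_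
  rw [ENNReal.iSup_mul, ENNReal.mul_iSup]
  refine iSup_le fun w => ?_
  obtain ⟨u, hu⟩ := u
  obtain ⟨w, hw⟩ := w
  simp only [Finset.mem_singleton, Finset.mem_compl, not_not] at hu hw
  have huw : ∀ m, u m = 0 ∨ w m = 0 := fun m => by
    by_cases hm : m = l
    · exact Or.inr (hw m hm)
    · exact Or.inl (hu m hm)
  refine le_trans ?_ (min_le_of_antitone hρ (coordS_add_coordS j x hi huw))
  refine le_min ?_ ?_
  · refine le_trans ?_ (hpol _)
    rw [prod_eq_mul_mul_prod_erase hi]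
    refine mul_le_mul' ?_ (mul_le_mul' ?_ (le_of_eq (Finset.prod_congr rfl fun i hi' => ?_)))
    · simp [hi]
    · simp
    · simp [hne i hi']
  · refine le_trans ?_ (hpol' _)
    rw [prod_eq_mul_mul_prod_erase hi]
    refine mul_le_mul' ?_ (mul_le_mul' ?_ (le_of_eq (Finset.prod_congr rfl fun i hi' => ?_)))
    -- Reflecting `x i₀ - u` in the axis `l` sends `-u` to `u`.
    · refine (min_le_right _ _).trans (le_of_eq ?_)
      congr 1
      simp only [true_or, if_true, Function.update_self, Function.update_of_ne hi]
      ext m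
      by_cases hm : m = l
      · simp [flipSigns, hm]; ring
      · simp [flipSigns, hm, hu m hm]
    · refine (min_le_right _ _).trans (le_of_eq ?_)
      -- Since `w` vanishes at `l`, the complementary reflection of `x i₁`, plus `w`, is minus the
      -- reflection of `x i₁ - w`; evenness absorbs the sign.
      rw [← heven]
      congr 1
      simp only [or_true, if_true, Function.update_self, flipSigns_compl, neg_signs_smul]
      ext m
      by_cases hm : m = l
      · simp [flipSigns, hm, hw l rfl]
      · simp [flipSigns, hm]; ring
    · simp [hne i hi']

/-- The values of `g` are unchanged by the sign changes `δ`. -/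
def SignInvariant {ι : Type*} (g : (ι → ℝ) → ℝ≥0∞) (δ : ι → ℤˣ) : Prop := ∀ x, g (δ • x) = g x

/-- Iterates `symmetrizePair` over the pairs in `A`. Sign changes commute, so no symmetry already
gained is lost; `hflip` abstracts what differs between the cases `j = k` and `j` even. -/
lemma exists_signInvariant_of_flip (j : ℕ) {k n : ℕ} {f : Fin k → (Fin n → ℝ) → ℝ≥0∞}
    {ρ : ℝ → ℝ≥0∞} (hρ : Antitone ρ) (hc : ∀ i, CompactSuperlevels (f i))
    (heven : ∀ i, SignInvariant (f i) (-1)) (hpol : ∀ x, ∏ i, f i (x i) ≤ ρ (coordS j x))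
    (i₀ : Fin k) (J : Finset (Fin k)) (hJ : i₀ ∉ J)
    (hflip : ∀ g : Fin k → (Fin n → ℝ) → ℝ≥0∞, (∀ x, ∏ i, g i (x i) ≤ ρ (coordS j x)) →
      (∀ i δ, SignInvariant (f i) δ → SignInvariant (g i) δ) → ∀ i₁ ∈ J, ∀ l : Fin n,
      ∀ x : Fin k → Fin n → ℝ, ∏ i, g i (if i = i₀ ∨ i = i₁ then flipSigns {l} • x i else x i)
        ≤ ρ (coordS j x)) (A : Finset (Fin k × Fin n)) (hA : ∀ p ∈ A, p.1 ∈ J) :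
    ∃ g : Fin k → (Fin n → ℝ) → ℝ≥0∞, (∀ i, CompactSuperlevels (g i)) ∧
      (∀ i δ, SignInvariant (f i) δ → SignInvariant (g i) δ) ∧
      (∀ x, ∏ i, g i (x i) ≤ ρ (coordS j x)) ∧ (∀ i, ∫⁻ x, f i x ≤ ∫⁻ x, g i x) ∧
      ∀ p ∈ A, SignInvariant (g p.1) (flipSigns {p.2}) ∧ SignInvariant (g i₀) (flipSigns {p.2}) := by
  induction A using Finset.induction_on with
  | empty => exact ⟨f, hc, fun _ _ h => h, hpol, fun _ => le_rfl, by simp⟩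
  | insert p A _ ih =>
    obtain ⟨g, hgc, hginv, hgpol, hgint, hgA⟩ := ih fun q hq => hA q (Finset.mem_insert_of_mem hq)
    obtain ⟨i₁, l⟩ := p
    have hi₁ : i₁ ∈ J := hA (i₁, l) (Finset.mem_insert_self _ _)
    have hi : i₀ ≠ i₁ := fun h => hJ (h ▸ hi₁)
    have hginv' : ∀ i δ, SignInvariant (g i) δ →
        SignInvariant (symmetrizePair i₀ i₁ l g i) δ := by
      intro i δ h
      unfold symmetrizePair
      split_ifs
      · exact symmetrize_smul _ h
      · exact symmetrize_smul _ h
      · exact h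
    have hg0 : SignInvariant (symmetrizePair i₀ i₁ l g i₀) (flipSigns {l}) := by
      simp only [symmetrizePair, if_true]
      exact symmetrize_flipSigns_smul _ _
    have hneg : ∀ i x, g i (-x) = g i x := fun i x => by
      have := hginv i (-1) (heven i) x
      rwa [neg_signs_smul, one_smul] at this
    have hg1 : SignInvariant (symmetrizePair i₀ i₁ l g i₁) (flipSigns {l}) := by
      intro x
      have h1 := hginv' i₁ _ (hginv i₁ _ (heven i₁)) (flipSigns {l} • x)
      rw [← h1, neg_signs_smul, one_smul, ← neg_signs_smul, ← flipSigns_compl]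
      simp only [symmetrizePair, if_neg hi.symm, if_true]
      exact symmetrize_flipSigns_smul _ _ _
    refine ⟨symmetrizePair i₀ i₁ l g, fun i => ?_, fun i δ h => hginv' i δ (hginv i δ h),
      prod_symmetrizePair_le j hρ hi l (hneg i₁) hgpol (hflip g hgpol hginv i₁ hi₁ l),
      fun i => (hgint i).trans ?_, fun q hq => ?_⟩
    · unfold symmetrizePair
      split_ifs
      · exact (hgc i).symmetrize _
      · exact (hgc i).symmetrize _
      · exact hgc i
    · unfold symmetrizePair
      split_ifs
      · exact lintegral_le_lintegral_symmetrize _ (hgc i)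
      · exact lintegral_le_lintegral_symmetrize _ (hgc i)
      · exact le_rfl
    · rcases Finset.mem_insert.1 hq with rfl | hq
      · exact ⟨hg1, hg0⟩
      · exact ⟨hginv' _ _ (hgA q hq).1, hginv' _ _ (hgA q hq).2⟩

lemma signInvariant_of_flipSigns {ι : Type*} [Fintype ι] [DecidableEq ι] {g : (ι → ℝ) → ℝ≥0∞}
    (hg : ∀ l, SignInvariant g (flipSigns {l})) (δ : ι → ℤˣ) : SignInvariant g δ := by
  rw [← Finset.univ_prod_mulSingle δ]
  refine Finset.prod_induction _ (SignInvariant g) (fun δ₁ δ₂ h₁ h₂ x => ?_) (fun x => ?_)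
    fun l _ => ?_
  · rw [← smul_smul, h₁, h₂]
  · rw [one_smul]
  · rcases Int.units_eq_one_or (δ l) with h | h
    · rw [h, Pi.mulSingle_one]
      intro x
      rw [one_smul]
    · convert hg l using 1
      ext m
      by_cases hm : m = l
      · subst hm; simp [h, flipSigns]
      · simp [hm, flipSigns]

/-- The functions can be made unconditional without decreasing their integrals. -/
lemma exists_signInvariant {j : ℕ} {k n : ℕ} (hj : 2 ≤ j) (hjk : j ≤ k)
    {f : Fin k → (Fin n → ℝ) → ℝ≥0∞}
    {ρ : ℝ → ℝ≥0∞} (hρ : Antitone ρ) (hc : ∀ i, CompactSuperlevels (f i))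
    (heven : ∀ i, SignInvariant (f i) (-1)) (hpol : ∀ x, ∏ i, f i (x i) ≤ ρ (coordS j x))
    (hcase : (∀ i δ, SignInvariant (f i) δ) ∨ j = k ∨
      (Even j ∧ ∀ i : Fin k, 2 ≤ (i : ℕ) → ∀ δ, SignInvariant (f i) δ)) :
    ∃ g : Fin k → (Fin n → ℝ) → ℝ≥0∞, (∀ i, CompactSuperlevels (g i)) ∧
      (∀ i δ, SignInvariant (g i) δ) ∧
      (∀ x, ∏ i, g i (x i) ≤ ρ (coordS j x)) ∧ (∀ i, ∫⁻ x, f i x ≤ ∫⁻ x, g i x) := by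
  have hk : 1 < k := hj.trans hjk
  have h0k : 0 < k := by omega
  rcases hcase with h | rfl | ⟨hje, h⟩
  · exact ⟨f, hc, h, hpol, fun _ => le_rfl⟩
  -- Here `elemSymm` is the full product, so flipping two of its factors changes nothing; index 0 is
  -- paired with every other index.
  · obtain ⟨g, hgc, -, hgpol, hgint, hg⟩ := exists_signInvariant_of_flip j hρ hc heven hpol
      ⟨0, by omega⟩ (Finset.univ.erase ⟨0, by omega⟩) (by simp) (fun g hgp _ i₁ hi₁ l x => by
        refine (hgp _).trans (le_of_eq ?_)
        congr 1
        refine Finset.sum_congr rfl fun m _ => ?_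
        rw [elemSymm_card, elemSymm_card]
        have hi : (⟨0, by omega⟩ : Fin j) ≠ i₁ := (Finset.ne_of_mem_erase hi₁).symm
        by_cases hm : m = l
        · subst hm
          rw [← Finset.mul_prod_erase _ _ (Finset.mem_univ (⟨0, by omega⟩ : Fin j)),
            ← Finset.mul_prod_erase _ _ hi₁, ← Finset.mul_prod_erase _ (fun i => x i m)
              (Finset.mem_univ (⟨0, by omega⟩ : Fin j)),
            ← Finset.mul_prod_erase _ (fun i => x i m) hi₁]
          rw [Finset.prod_congr rfl (g := fun i => x i m)]
          · simp [flipSigns]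
          · intro i hi'
            simp only [Finset.mem_erase, Finset.mem_univ, and_true] at hi'
            simp [hi'.1, hi'.2]
        · refine Finset.prod_congr rfl fun i _ => ?_
          beta_reduce
          split_ifs <;> simp [flipSigns, hm]) (Finset.univ.erase ⟨0, by omega⟩ ×ˢ Finset.univ)
      (fun p hp => (Finset.mem_product.1 hp).1)
    refine ⟨g, hgc, fun i => signInvariant_of_flipSigns fun l => ?_, hgpol, hgint⟩
    by_cases hi : i = ⟨0, by omega⟩
    · subst hi
      exact (hg (⟨1, by omega⟩, l) (by simp)).2
    · exact (hg (i, l) (by simp [hi])).1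
  -- The unconditional functions let the flip be applied to all `k` arguments at once, and `elemSymm
  -- j` is even. Only indices 0 and 1 need symmetrizing.
  · obtain ⟨g, hgc, hginv, hgpol, hgint, hg⟩ := exists_signInvariant_of_flip j hρ hc heven hpol
      ⟨0, h0k⟩ {⟨1, hk⟩} (by simp) (fun g hgp hginv i₁ hi₁ l x => by
        rw [Finset.mem_singleton] at hi₁
        subst hi₁
        have h1 : ∏ i, g i (if i = ⟨0, h0k⟩ ∨ i = ⟨1, hk⟩ then flipSigns {l} • x i else x i)
            = ∏ i, g i (flipSigns {l} • x i) := by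
          refine Finset.prod_congr rfl fun i _ => ?_
          split_ifs with hi
          · rfl
          · rw [not_or, Fin.ext_iff, Fin.ext_iff] at hi
            refine (hginv i _ (h i ?_ _) _).symm
            have := hi.1; have := hi.2
            simp only at *
            omega
        rw [h1]
        refine (hgp _).trans (le_of_eq ?_)
        congr 1
        refine Finset.sum_congr rfl fun m _ => ?_
        by_cases hm : m = l
        · subst hm
          rw [← elemSymm_neg hje]
          simp [flipSigns]
        · simp [flipSigns, hm]) ({⟨1, hk⟩} ×ˢ Finset.univ)
      (fun p hp => (Finset.mem_product.1 hp).1)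
    refine ⟨g, hgc, fun i => ?_, hgpol, hgint⟩
    by_cases hi : 2 ≤ (i : ℕ)
    · exact fun δ => hginv i δ (h i hi δ)
    refine signInvariant_of_flipSigns fun l => ?_
    have hg' := hg (⟨1, hk⟩, l) (by simp)
    obtain hi0 | hi1 : i = ⟨0, h0k⟩ ∨ i = ⟨1, hk⟩ := by
      rw [Fin.ext_iff, Fin.ext_iff]
      simp only
      omega
    · exact hi0 ▸ hg'.2
    · exact hi1 ▸ hg'.1

end Polarity

/-! ### The unconditional case. -/

section UnconditionalCase

/-- Each index lies in `(card ι - 1).choose (j - 1)` subsets of size `j`. -/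
lemma prod_powersetCard_prod {ι M : Type*} [Fintype ι] [DecidableEq ι] [CommMonoid M] {j : ℕ}
    (hj : 0 < j) (r : ι → M) :
    ∏ t ∈ Finset.powersetCard j Finset.univ, ∏ i ∈ t, r i =
      (∏ i, r i) ^ (Fintype.card ι - 1).choose (j - 1) := by
  have h : ∀ t : Finset ι, ∏ i ∈ t, r i = ∏ i, if i ∈ t then r i else 1 := fun t => by
    simp [Finset.prod_ite_mem]
  simp only [h]
  rw [Finset.prod_comm, ← Finset.prod_pow]
  refine Finset.prod_congr rfl fun i _ => ?_
  rw [← Finset.prod_filter, Finset.prod_const]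
  rw [if_pos (Finset.mem_univ i)]
  congr 1
  have := Finset.card_filter_powersetCard_subset {i} (Finset.univ : Finset ι) j (by simp)
    (by simp; omega)
  simpa using this

/-- Maclaurin's inequality between the elementary symmetric mean and the geometric mean. -/
lemma choose_mul_prod_rpow_pow_le_elemSymm {j k : ℕ} (hj : 0 < j) (hjk : j ≤ k) {r : Fin k → ℝ}
    (hr : ∀ i, 0 ≤ r i) :
    (k.choose j : ℝ) * ((∏ i, r i) ^ ((k : ℝ)⁻¹)) ^ j ≤ elemSymm j r := by
  have hN : (0 : ℝ) < k.choose j := by exact_mod_cast Nat.choose_pos hjk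
  have hk : (0 : ℝ) < k := by exact_mod_cast hj.trans_le hjk
  have hP : 0 ≤ ∏ i, r i := Finset.prod_nonneg fun i _ => hr i
  have h := Real.geom_mean_le_arith_mean_weighted
    (Finset.powersetCard j (Finset.univ : Finset (Fin k))) (fun _ => (k.choose j : ℝ)⁻¹)
    (fun t => ∏ i ∈ t, r i) (fun _ _ => by positivity)
    (by simp [Finset.card_powersetCard, hN.ne']) fun t _ => Finset.prod_nonneg fun i _ => hr i
  rw [Real.finsetProd_rpow _ _ fun t _ => Finset.prod_nonneg fun i _ => hr i,
    prod_powersetCard_prod hj, ← Finset.mul_sum, ← elemSymm_eq_sum, Fintype.card_fin] at h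
  -- The exponent of `∏ i, r i` after AM–GM over all `j`-subsets.
  have hexp : (((k - 1).choose (j - 1) : ℕ) : ℝ) * (k.choose j : ℝ)⁻¹ = (k : ℝ)⁻¹ * j := by
    have := Nat.add_one_mul_choose_eq (k - 1) (j - 1)
    rw [Nat.sub_add_cancel hj, Nat.sub_add_cancel (hj.trans_le hjk)] at this
    have h' : (k : ℝ) * ((k - 1).choose (j - 1) : ℕ) = k.choose j * j := by exact_mod_cast this
    field_simp
    linarith
  rw [← Real.rpow_natCast, ← Real.rpow_mul hP, hexp, Real.rpow_mul hP, Real.rpow_natCast] at h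
  calc _ ≤ (k.choose j : ℝ) * ((k.choose j : ℝ)⁻¹ * elemSymm j r) := by gcongr
    _ = _ := by rw [mul_inv_cancel_left₀ hN.ne']

instance : SigmaFinite absVolume := by
  have : IsFiniteMeasureOnCompacts absVolume := ⟨fun K hK => by
    rw [absVolume, Measure.map_apply measurable_abs hK.measurableSet]
    refine Bornology.IsBounded.measure_lt_top ?_
    obtain ⟨R, hR⟩ := hK.isBounded.exists_norm_le
    refine (Metric.isBounded_closedBall (x := (0 : ℝ)) (r := R)).subset fun x hx => ?_
    simpa using hR _ hx⟩
  infer_instance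

lemma lintegral_pi_absVolume {n : ℕ} {F : (Fin n → ℝ) → ℝ≥0∞} (hF : Measurable F)
    (habs : ∀ x, F (fun l => |x l|) = F x) :
    ∫⁻ x, F x ∂(Measure.pi fun _ : Fin n => absVolume) = ∫⁻ x, F x := by
  have hs : ∀ _ : Fin n, SigmaFinite ((volume : Measure ℝ).map abs) := fun _ =>
    inferInstanceAs (SigmaFinite absVolume)
  unfold absVolume
  rw [← Measure.pi_map_pi (hμ := hs) fun _ => measurable_abs.aemeasurable, lintegral_map hF (by fun_prop),
    ← volume_pi]
  exact lintegral_congr habs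

lemma SignInvariant.apply_abs {ι : Type*} {g : (ι → ℝ) → ℝ≥0∞} (hg : ∀ δ, SignInvariant g δ)
    (x : ι → ℝ) : g (fun l => |x l|) = g x := by
  rw [← hg (fun l => if x l < 0 then -1 else 1) x]
  congr 1
  ext l
  simp only [Pi.smul_apply']
  split_ifs with h
  · simp [abs_of_neg h, Units.neg_smul]
  · simp [abs_of_nonneg (not_lt.1 h)]

lemma prod_lintegral_le_of_signInvariant {j k n : ℕ} (hj : 0 < j) (hjk : j ≤ k)
    {g : Fin k → (Fin n → ℝ) → ℝ≥0∞} {ρ : ℝ → ℝ≥0∞} (hρ : Antitone ρ)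
    (hg : ∀ i, Measurable (g i)) (hinv : ∀ i δ, SignInvariant (g i) δ)
    (hpol : ∀ x, ∏ i, g i (x i) ≤ ρ (coordS j x)) :
    ∏ i, ∫⁻ x, g i x ≤
      (∫⁻ u : Fin n → ℝ, ρ ((k.choose j : ℝ) * ∑ l, |u l| ^ j) ^ (1 / (k : ℝ))) ^ k := by
  have hk : k ≠ 0 := by omega
  have hh : Measurable fun u : Fin n → ℝ =>
      ρ ((k.choose j : ℝ) * ∑ l, |u l| ^ j) ^ (1 / (k : ℝ)) := by
    have := hρ.measurable
    fun_prop
  rw [← lintegral_pi_absVolume hh fun x => by simp only [abs_abs],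
    Finset.prod_congr rfl fun i _ =>
      (lintegral_pi_absVolume (hg i) fun x => SignInvariant.apply_abs (hinv i) x).symm]
  refine (prekopaLeindler_absVolume hk).pi g _ hg hh fun x => ?_
  rw [one_div, ENNReal.rpow_inv_natCast_pow hk]
  calc ∏ i, g i (x i) = ∏ i, g i (fun l => |x i l|) :=
        Finset.prod_congr rfl fun i _ => (SignInvariant.apply_abs (hinv i) _).symm
    _ ≤ ρ (coordS j fun i l => |x i l|) := hpol _
    _ ≤ _ := by
        refine hρ ?_
        rw [coordS, Finset.mul_sum]
        refine Finset.sum_le_sum fun l _ => ?_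
        refine le_trans (le_of_eq ?_)
          (choose_mul_prod_rpow_pow_le_elemSymm hj hjk fun i => abs_nonneg (x i l))
        rw [abs_of_nonneg (Real.rpow_nonneg (Finset.prod_nonneg fun i _ => abs_nonneg _) _)]

end UnconditionalCase

/-! ### Approximation by functions with compact superlevel sets. -/

section Approximation

lemma CompactSuperlevels.comp_signs_smul {ι : Type*} {ψ : (ι → ℝ) → ℝ≥0∞}
    (hψ : CompactSuperlevels ψ) (δ : ι → ℤˣ) : CompactSuperlevels fun x => ψ (δ • x) := by
  intro c hc
  have hcont : Continuous fun x : ι → ℝ => δ • x :=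
    continuous_pi fun l => (continuous_apply l).const_smul (δ l)
  convert (hψ c hc).image hcont using 1
  ext x
  constructor
  · intro hx
    exact ⟨δ • x, hx, signs_smul_smul δ x⟩
  · rintro ⟨y, hy, rfl⟩
    simpa only [Set.mem_ofPred_eq, signs_smul_smul] using hy

/-- The maximum of `ψ` over the finite group of sign changes preserving `F` restores the symmetries
of `F` and stays below `F`. -/
lemma exists_signInvariant_compactSuperlevels {ι : Type*} [Fintype ι] {F ψ : (ι → ℝ) → ℝ≥0∞}
    (hψ : CompactSuperlevels ψ) (hψF : ∀ x, ψ x ≤ F x) :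
    ∃ g : (ι → ℝ) → ℝ≥0∞, CompactSuperlevels g ∧ (∀ x, ψ x ≤ g x) ∧ (∀ x, g x ≤ F x) ∧
      ∀ δ, SignInvariant F δ → SignInvariant g δ := by
  classical
  set G : Finset (ι → ℤˣ) := Finset.univ.filter (SignInvariant F) with hG
  have hmem : ∀ δ, δ ∈ G ↔ SignInvariant F δ := fun δ => by simp [hG]
  refine ⟨fun x => G.sup fun δ => ψ (δ • x), fun c hc => ?_, fun x => ?_, fun x => ?_,
    fun δ hδ => ?_⟩
  · have : {x | c ≤ G.sup fun δ => ψ (δ • x)} = ⋃ δ ∈ G, {x | c ≤ ψ (δ • x)} := by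
      ext x
      simp [Finset.le_sup_iff (pos_iff_ne_zero.2 hc)]
    rw [this]
    exact G.isCompact_biUnion fun δ _ => CompactSuperlevels.comp_signs_smul hψ δ c hc
  · have h1 : (1 : ι → ℤˣ) ∈ G := (hmem 1).2 fun x => by rw [one_smul]
    simpa using Finset.le_sup (f := fun δ : ι → ℤˣ => ψ (δ • x)) h1
  · exact Finset.sup_le fun δ hδ => (hψF _).trans ((hmem δ).1 hδ x).le
  · have key : ∀ x, (G.sup fun ε => ψ (ε • δ • x)) ≤ G.sup fun ε => ψ (ε • x) := fun x => by
      refine Finset.sup_le fun ε hε => ?_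
      rw [smul_smul]
      refine Finset.le_sup (f := fun ε : ι → ℤˣ => ψ (ε • x)) ((hmem _).2 fun y => ?_)
      rw [← smul_smul, (hmem ε).1 hε, hδ]
    intro x
    refine le_antisymm (key x) ?_
    have := key (δ • x)
    rwa [signs_smul_smul] at this

/-- Vitali–Carathéodory gives an upper semicontinuous minorant; cutting it off outside a large
closed ball makes the closed superlevel sets compact. -/
lemma exists_compactSuperlevels_lt_lintegral {n : ℕ} {F : (Fin n → ℝ) → ℝ≥0∞}
    (hF : ∀ x, F x ≠ ∞) (hint : ∫⁻ x, F x ≠ ∞) {a : ℝ≥0∞} (ha : a < ∫⁻ x, F x) :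
    ∃ ψ : (Fin n → ℝ) → ℝ≥0∞, CompactSuperlevels ψ ∧ (∀ x, ψ x ≤ F x) ∧ a < ∫⁻ x, ψ x := by
  lift F to (Fin n → ℝ) → NNReal using hF
  beta_reduce at hint ha
  obtain ⟨b, hab, hb⟩ := exists_between ha
  obtain ⟨φ, hφF, hφ, hφint⟩ := exists_upperSemicontinuous_le_lintegral_le F hint
    (tsub_pos_of_lt hb).ne'
  have hφb : a < ∫⁻ x, (φ x : ℝ≥0∞) := by
    refine hab.trans_le ((ENNReal.add_le_add_iff_right
      (ne_top_of_le_ne_top hint (tsub_le_self (b := b)))).1 ?_)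
    rwa [add_tsub_cancel_of_le hb.le]
  have hmono : Monotone fun N : ℕ => (Metric.closedBall (0 : Fin n → ℝ) N).indicator
      fun x => (φ x : ℝ≥0∞) := fun N N' hN => Set.indicator_le_indicator_of_subset
        (Metric.closedBall_subset_closedBall (by exact_mod_cast hN)) fun _ => zero_le
  have hmeas : Measurable fun x => (φ x : ℝ≥0∞) := hφ.measurable.coe_nnreal_ennreal
  have hsup : ∫⁻ x, (φ x : ℝ≥0∞) = ⨆ N : ℕ, ∫⁻ x,
      (Metric.closedBall (0 : Fin n → ℝ) N).indicator (fun x => (φ x : ℝ≥0∞)) x := by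
    rw [← lintegral_iSup (fun N => hmeas.indicator Metric.isClosed_closedBall.measurableSet) hmono]
    refine lintegral_congr fun x => le_antisymm ?_ (iSup_le fun N => Set.indicator_le_self _ _ _)
    obtain ⟨N, hN⟩ := exists_nat_ge ‖x‖
    refine le_iSup_of_le N ?_
    rw [Set.indicator_of_mem (by simpa using hN)]
  rw [hsup] at hφb
  obtain ⟨N, hN⟩ := lt_iSup_iff.1 hφb
  refine ⟨_, fun c hc => ?_, fun x => (Set.indicator_le_self _ _ x).trans
    (ENNReal.coe_le_coe.2 (hφF x)), hN⟩
  have hset : {x | c ≤ (Metric.closedBall (0 : Fin n → ℝ) N).indicator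
      (fun x => (φ x : ℝ≥0∞)) x} = Metric.closedBall 0 N ∩ {x | c ≤ φ x} := by
    ext x
    by_cases hx : x ∈ Metric.closedBall (0 : Fin n → ℝ) N
    · simp only [Set.mem_ofPred_eq, Set.indicator_of_mem hx, Set.mem_inter_iff, hx, true_and]
    · simp only [Set.mem_ofPred_eq, Set.indicator_of_notMem hx, Set.mem_inter_iff, hx, false_and,
        le_zero_iff, hc]
  rw [hset]
  refine (isCompact_closedBall _ _).inter_right ?_
  by_cases hct : c = ∞
  · simp [hct]
  · lift c to NNReal using hct
    simp only [ENNReal.coe_le_coe]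
    exact upperSemicontinuous_iff_isClosed_preimage.1 hφ c

/-- The inequality in coordinates. -/
theorem prod_lintegral_le {j k n : ℕ} (hj : 2 ≤ j) (hjk : j ≤ k)
    {F : Fin k → (Fin n → ℝ) → ℝ≥0∞} {ρ : ℝ → ℝ≥0∞} (hρ : Antitone ρ)
    (hF : ∀ i x, F i x ≠ ∞) (hint : ∀ i, ∫⁻ x, F i x ≠ ∞)
    (heven : ∀ i, SignInvariant (F i) (-1)) (hpol : ∀ x, ∏ i, F i (x i) ≤ ρ (coordS j x))
    (hcase : (∀ i δ, SignInvariant (F i) δ) ∨ j = k ∨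
      (Even j ∧ ∀ i : Fin k, 2 ≤ (i : ℕ) → ∀ δ, SignInvariant (F i) δ)) :
    ∏ i, ∫⁻ x, F i x ≤
      (∫⁻ u : Fin n → ℝ, ρ ((k.choose j : ℝ) * ∑ l, |u l| ^ j) ^ (1 / (k : ℝ))) ^ k := by
  by_cases h0 : ∃ i, ∫⁻ x, F i x = 0
  · obtain ⟨i, hi⟩ := h0
    rw [Finset.prod_eq_zero (Finset.mem_univ i) hi]
    exact zero_le
  push Not at h0
  -- The loss factor `c` leaves room for strict approximation from below, and `c → 1` recovers the
  -- claim.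
  have key : ∀ c : ℝ≥0∞, c < 1 → c ^ k * ∏ i, ∫⁻ x, F i x ≤
      (∫⁻ u : Fin n → ℝ, ρ ((k.choose j : ℝ) * ∑ l, |u l| ^ j) ^ (1 / (k : ℝ))) ^ k := by
    intro c hc
    have hex : ∀ i, ∃ g : (Fin n → ℝ) → ℝ≥0∞, CompactSuperlevels g ∧
        c * ∫⁻ x, F i x ≤ ∫⁻ x, g x ∧ (∀ x, g x ≤ F i x) ∧
        ∀ δ, SignInvariant (F i) δ → SignInvariant g δ := by
      intro i
      obtain ⟨ψ, hψ, hψF, hψint⟩ := exists_compactSuperlevels_lt_lintegral (hF i) (hint i)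
        (a := c * ∫⁻ x, F i x) (by
          conv_rhs => rw [← one_mul (∫⁻ x, F i x)]
          exact (ENNReal.mul_lt_mul_iff_left (h0 i) (hint i)).2 hc)
      obtain ⟨g, hg, hψg, hgF, hginv⟩ := exists_signInvariant_compactSuperlevels hψ hψF
      exact ⟨g, hg, hψint.le.trans (lintegral_mono hψg), hgF, hginv⟩
    choose g hgc hgint hgF hginv using hex
    obtain ⟨g', hgc', hginv', hgpol', hgint'⟩ := exists_signInvariant hj hjk hρ hgc
      (fun i => hginv i _ (heven i))
      (fun x => (Finset.prod_le_prod' fun i _ => hgF i (x i)).trans (hpol x))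
      (hcase.imp (fun h i δ => hginv i δ (h i δ)) (Or.imp_right fun h =>
        ⟨h.1, fun i hi δ => hginv i δ (h.2 i hi δ)⟩))
    refine le_trans ?_ (prod_lintegral_le_of_signInvariant (by omega) hjk hρ
      (fun i => (hgc' i).measurable) hginv' hgpol')
    calc c ^ k * ∏ i, ∫⁻ x, F i x = ∏ i, c * ∫⁻ x, F i x := by
          rw [Finset.prod_mul_distrib]; simp
      _ ≤ _ := Finset.prod_le_prod' fun i _ => (hgint i).trans (hgint' i)
  have hlim : Filter.Tendsto (fun c : ℝ≥0∞ => c ^ k * ∏ i, ∫⁻ x, F i x)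
      (nhdsWithin 1 (Set.Iio 1)) (nhds (∏ i, ∫⁻ x, F i x)) := by
    have h1 : Filter.Tendsto (fun c : ℝ≥0∞ => c ^ k) (nhdsWithin 1 (Set.Iio 1)) (nhds 1) := by
      have := ((ENNReal.continuous_pow k).tendsto 1).mono_left
        (nhdsWithin_le_nhds (s := Set.Iio (1 : ℝ≥0∞)))
      simpa using this
    simpa using ENNReal.Tendsto.mul_const h1
      (Or.inr (ENNReal.prod_ne_top fun i _ => hint i))
  have : (nhdsWithin (1 : ℝ≥0∞) (Set.Iio 1)).NeBot := nhdsLT_neBot_of_exists_lt ⟨0, one_pos⟩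
  exact le_of_tendsto hlim (by
    filter_upwards [self_mem_nhdsWithin] with c hc using key c hc)

end Approximation

/-! ### Passage from an orthonormal basis to coordinates. -/

section Transfer

variable {E : Type*} [NormedAddCommGroup E] [InnerProductSpace ℝ E] {n : ℕ}

/-- The point of `E` with given coordinates in an orthonormal basis. -/
noncomputable def ofCoords (b : OrthonormalBasis (Fin n) ℝ E) (v : Fin n → ℝ) : E :=
  ∑ m, v m • b m

lemma inner_ofCoords (b : OrthonormalBasis (Fin n) ℝ E) (v : Fin n → ℝ) (l : Fin n) :
    inner ℝ (ofCoords b v) (b l) = v l := by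
  simp [ofCoords, sum_inner, inner_smul_left, b.inner_eq_ite]

lemma ofCoords_eq (b : OrthonormalBasis (Fin n) ℝ E) (v : Fin n → ℝ) :
    ofCoords b v = b.repr.symm (WithLp.toLp 2 v) := by
  rw [← b.sum_repr_symm]
  rfl

lemma lintegral_comp_ofCoords [FiniteDimensional ℝ E] [MeasurableSpace E] [BorelSpace E]
    (b : OrthonormalBasis (Fin n) ℝ E) (F : E → ℝ≥0∞) :
    ∫⁻ v, F (ofCoords b v) = ∫⁻ x, F x := by
  set e : (Fin n → ℝ) ≃ᵐ E :=
    (MeasurableEquiv.toLp 2 (Fin n → ℝ)).trans b.measurableEquiv.symm with he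
  have hmp : MeasurePreserving e := by
    refine MeasurePreserving.trans (e' := b.measurableEquiv.symm) ?_
      (b.measurePreserving_measurableEquiv.symm _)
    exact PiLp.volume_preserving_toLp (Fin n)
  rw [← hmp.lintegral_comp_emb e.measurableEmbedding]
  refine lintegral_congr fun v => ?_
  rw [ofCoords_eq]
  rfl

lemma bigS_ofCoords (b : OrthonormalBasis (Fin n) ℝ E) (j : ℕ) {k : ℕ} (x : Fin k → Fin n → ℝ) :
    bigS b j (fun i => ofCoords b (x i)) = coordS j x := by
  simp only [bigS, coordS, inner_ofCoords]

lemma pNorm_ofCoords_pow (b : OrthonormalBasis (Fin n) ℝ E) {j : ℕ} (hj : j ≠ 0)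
    (v : Fin n → ℝ) : pNorm b j (ofCoords b v) ^ j = ∑ l, |v l| ^ j := by
  simp only [pNorm, inner_ofCoords, one_div, Real.rpow_natCast]
  exact Real.rpow_inv_natCast_pow (Finset.sum_nonneg fun l _ => by positivity) hj

lemma Unconditional.signInvariant {b : OrthonormalBasis (Fin n) ℝ E} {f : E → ℝ}
    (hf : Unconditional b f) (δ : Fin n → ℤˣ) :
    SignInvariant (fun v => ENNReal.ofReal (f (ofCoords b v))) δ := by
  intro v
  have := hf (fun m => ((δ m : ℤ) : ℝ)) (fun m => by
    rcases Int.units_eq_one_or (δ m) with h | h <;> simp [h]) v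
  simp only [ofCoords]
  rw [← this]
  congr 4
  ext m
  congr 1
  simp [Units.smul_def]

end Transfer

end JSantalo

theorem mainTheorem2 {E : Type*} [NormedAddCommGroup E] [InnerProductSpace ℝ E]
    [FiniteDimensional ℝ E] [MeasurableSpace E] [BorelSpace E]
    {n : ℕ} (b : OrthonormalBasis (Fin n) ℝ E)
    (j k : ℕ) (hj : 2 ≤ j) (hjk : j ≤ k)
    (f : Fin k → E → ℝ) (hf_nonneg : ∀ i x, 0 ≤ f i x)
    (hf_even : ∀ i, Function.Even (f i))
    (hf_int : ∀ i, MeasureTheory.Integrable (f i) MeasureTheory.volume)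
    (ρ : ℝ → ENNReal) (hρ : Antitone ρ)
    (hpol : JSantalo.PolarityCondition (JSantalo.bigS b j) f ρ)
    (hcase : (∀ i, JSantalo.Unconditional b (f i)) ∨
      j = k ∨
      (Even j ∧ ∀ i : Fin k, 2 ≤ (i : ℕ) → JSantalo.Unconditional b (f i))) :
    ENNReal.ofReal (∏ i, ∫ x, f i x) ≤
      (∫⁻ u : E, ρ ((k.choose j : ℝ) * JSantalo.pNorm b (j : ℝ) u ^ j) ^ (1 / (k : ℝ))) ^ k := by
  have hint : ∀ i, ∫⁻ v, ENNReal.ofReal (f i (JSantalo.ofCoords b v)) =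
      ENNReal.ofReal (∫ x, f i x) := fun i => by
    rw [JSantalo.lintegral_comp_ofCoords b fun x => ENNReal.ofReal (f i x),
      ofReal_integral_eq_lintegral_ofReal (hf_int i) (Filter.Eventually.of_forall (hf_nonneg i))]
  have key := JSantalo.prod_lintegral_le (n := n) hj hjk
    (F := fun i v => ENNReal.ofReal (f i (JSantalo.ofCoords b v))) hρ
    (fun _ _ => ENNReal.ofReal_ne_top) (fun i => by rw [hint]; exact ENNReal.ofReal_ne_top)
    (fun i v => by
      have : JSantalo.ofCoords b ((-1 : Fin n → ℤˣ) • v) = -JSantalo.ofCoords b v := by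
        simp [JSantalo.ofCoords]
      simp only [this, hf_even i _])
    (fun x => by
      rw [← ENNReal.ofReal_prod_of_nonneg fun i _ => hf_nonneg i _, ← JSantalo.bigS_ofCoords b]
      exact hpol _)
    (hcase.imp (fun h i => (h i).signInvariant) (Or.imp_right fun h =>
      ⟨h.1, fun i hi => (h.2 i hi).signInvariant⟩))
  simp only [hint] at key
  rw [ENNReal.ofReal_prod_of_nonneg fun i _ => integral_nonneg (hf_nonneg i)]
  refine key.trans (le_of_eq ?_)
  rw [← JSantalo.lintegral_comp_ofCoords b]
  simp only [JSantalo.pNorm_ofCoords_pow b (show j ≠ 0 by omega)]
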